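/- **Proposition (blow-up of the Brockett–Wegner flow).** For unbounded operators on a Hilbert space, products and commutators $[A,B]=AB-BA$ are taken on their natural domains. Let $X$ and $Y_t$, $t\in[0,T)$, be closed operators and let $\mathcal C\subseteq\mathcal D$ be subspaces. We say that $(Y_t)_{t\in[0,T)}$ is a *local solution on $\mathcal D$, with core $\mathcal C$*, of the Brockett–Wegner flow $\partial_tY_t=[Y_t,[Y_t,X]]$ if * $\mathcal C$ is a core of $X$ and of every $Y_t$; * for $\varphi\in\mathcal C$ the vector $[Y_t,[Y_t,X]]\varphi$ is defined for every $t\in[0,T)$, and $t\mapsto Y_t\varphi$ is norm-differentiable on $[0,T)$ with derivative $[Y_t,[Y_t,X]]\varphi$; * for every $\varphi\in\mathcal D$ one has $\varphi\in\mathcal D(Y_t)$ for all $t\in[0,T)$, and $t\mapsto Y_t\varphi$ is norm-differentiable on $[0,T)$ with derivative $\overline{[Y_t,[Y_t,X]]}\,\varphi$ (the bar denotes the closure). **(i)** There exist a separable complex Hilbert space, a time $T_{\max}\in(0,\infty)$, an unbounded self-adjoint operator $X\ge 0$ and unbounded self-adjoint operators $(Y_t)_{t\in[0,T_{\max})}$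 with $\mathcal D(Y_t)=\mathcal D(Y_0)$ for all $t\in[0,T_{\max})$, which are a local solution of the Brockett–Wegner flow on $\mathcal D(Y_0)$ with some core $\mathcal C$, such that $$\lim_{t\nearrow T_{\max}}\|Y_t\varphi\|=\infty\qquad\text{for every non-zero }\varphi\in\mathcal D(Y_0).$$ **(ii)** Two-mode example. Let $a_\pm,a_\pm^*$ be the annihilation and creation operators of two boson modes on the boson Fock space over $\mathbb C^2$, let $\mathcal C$ be the subspace of vectors with boundedly many particles, and let $X=\mathrm N$ be the closure of $a_-^*a_-+a_+^*a_+$ on $\mathcal C$. For real $\omega_-,\omega_+,b,c$ let $H(\omega_-,\omega_+,b,c)$ be the closure of the operator $$\omega_-a_-^*a_-+\omega_+a_+^*a_++2b\,(a_+^*a_-^*+a_-a_+)+c$$ on $\mathcal C$, that is, of the quadratic operator $\sum_{k,\ell}\Omega_{k\ell}a_k^*a_\ell+B_{k\ell}a_k^*a_\ell^*+\overline{B_{k\ell}}a_ka_\ell+c$ with $\Omega=\begin{pmatrix}\omega_-&0\\0&\omega_+\end{pmatrix}$ and $B=\begin{pmatrix}0&b\\b&0\end{pmatrix}$. For every $b>0$,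 with $T_{\max}=\pi/(16b)$, there are real functions $\omega_{\pm,t},b_t,c_t$ with $\omega_{\pm,0}=0$, $b_0=b$, $c_0=0$ such that, for $Y_t:=H(\omega_{-,t},\omega_{+,t},b_t,c_t)$: the operator $X\ge0$ and all $Y_t$, $t\in[0,T_{\max})$, are self-adjoint and unbounded; all $Y_t$ have the common core $\mathcal C$, and $\mathcal D(\mathrm N)\subseteq\mathcal D(Y_t)$; $(Y_t)_{t\in[0,T_{\max})}$ is a local solution of the Brockett–Wegner flow on $\mathcal D(\mathrm N)$ with core $\mathcal C$; and $\lim_{t\nearrow T_{\max}}\|Y_t\varphi\|=\infty$ for every non-zero $\varphi\in\mathcal D(\mathrm N)$. -/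

import Mathlib

open Filter Topology

/-! ### Unbounded operators -/

section Operators

variable {F : Type*} [NormedAddCommGroup F] [InnerProductSpace ℂ F]

/-- The product `A B` of two unbounded operators on its natural domain
`{x ∈ D(B) | B x ∈ D(A)}`. -/
noncomputable def LinearPMap.mulOp (A B : F →ₗ.[ℂ] F) : F →ₗ.[ℂ] F :=
  A.comp (B.domRestrict ((A.domain.comap B.toFun).map B.domain.subtype)) (by
    rintro ⟨x, hx, hxB⟩
    obtain ⟨y, hy, hyx⟩ := hx
    have h : (B.domRestrict ((A.domain.comap B.toFun).map B.domain.subtype))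
        ⟨x, ⟨⟨y, hy, hyx⟩, hxB⟩⟩ = B y :=
      LinearPMap.domRestrict_apply hyx.symm
    rw [h]
    exact hy)

/-- The commutator `[A, B] = A B - B A` on its natural domain `D(A B) ∩ D(B A)`. -/
noncomputable def LinearPMap.commOp (A B : F →ₗ.[ℂ] F) : F →ₗ.[ℂ] F :=
  A.mulOp B - B.mulOp A

/-- The operator is unbounded. -/
def LinearPMap.IsUnbounded (A : F →ₗ.[ℂ] F) : Prop :=
  ¬ ∃ C : ℝ, ∀ x : A.domain, ‖A x‖ ≤ C * ‖(x : F)‖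

/-- `0 ≤ A` in the sense of quadratic forms. -/
def LinearPMap.IsNonneg (A : F →ₗ.[ℂ] F) : Prop :=
  ∀ x : A.domain, 0 ≤ (inner ℂ (x : F) (A x)).re

/-- `(Y t)` for `t ∈ [0, T)` solves the Brockett-Wegner flow `∂ₜ Y = [Y, [Y, X]]`:
* the subspace `C ≤ D` is a core of `X` and of every `Y t`;
* on `C` the double commutator is defined as it stands, and for `φ ∈ C` the curve `t ↦ Y t φ` is
  norm-differentiable with derivative `[Y t, [Y t, X]] φ`;
* every `φ ∈ D` lies in the domain of every `Y t`, and `t ↦ Y t φ` is norm-differentiable, the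
  derivative being given by the closure of the operator `[Y t, [Y t, X]]`. -/
structure IsLocalFlow (X : F →ₗ.[ℂ] F) (Y : ℝ → F →ₗ.[ℂ] F) (T : ℝ)
    (C D : Submodule ℂ F) : Prop where
  core_le : C ≤ D
  core_X : X.HasCore C
  core_Y : ∀ t ∈ Set.Ico 0 T, (Y t).HasCore C
  flow_core : ∀ φ ∈ C, ∃ u v : ℝ → F, ∀ t ∈ Set.Ico 0 T,
    (φ, u t) ∈ (Y t).graph ∧
    (φ, v t) ∈ ((Y t).commOp ((Y t).commOp X)).graph ∧
    HasDerivWithinAt u (v t) (Set.Ico 0 T) t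
  flow_dom : ∀ φ ∈ D, ∃ u v : ℝ → F, ∀ t ∈ Set.Ico 0 T,
    (φ, u t) ∈ (Y t).graph ∧
    (φ, v t) ∈ ((Y t).commOp ((Y t).commOp X)).graph.topologicalClosure ∧
    HasDerivWithinAt u (v t) (Set.Ico 0 T) t

/-- For every non-zero `φ ∈ D` (which lies in all the domains `D(Y t)`, `0 ≤ t < T`),
`‖Y t φ‖ → ∞` as `t ↗ T`. -/
def BlowsUpOn (Y : ℝ → F →ₗ.[ℂ] F) (T : ℝ) (D : Submodule ℂ F) : Prop :=
  ∀ φ ∈ D, φ ≠ 0 → ∃ u : ℝ → F, (∀ t ∈ Set.Ico 0 T, (φ, u t) ∈ (Y t).graph) ∧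
    Tendsto (fun t => ‖u t‖) (𝓝[<] T) atTop

end Operators

/-! ### Quadratic boson operators with finitely many modes -/

section Bosons

variable (ι : Type*)

/-- The boson Fock space over the one-particle space `ℂ^ι`, in the occupation number
representation: `ψ n` is the component of `ψ` along the normalized state with `n k` particles in
the mode `k`. -/
noncomputable abbrev BosonFock := lp (fun _ : ι → ℕ => ℂ) 2

/-- The vectors with boundedly many particles. As there are finitely many modes, these are the
finite combinations of occupation number states. -/
noncomputable def finiteParticle : Submodule ℂ (BosonFock ι) where
  carrier := {ψ | {n | (ψ : (ι → ℕ) → ℂ) n ≠ 0}.Finite}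
  zero_mem' := by simp
  add_mem' {ψ χ} hψ hχ := by
    refine (hψ.union hχ).subset fun n hn => ?_
    by_contra h
    simp only [Set.mem_union, Set.mem_ofPred_eq, not_or, not_not] at h
    exact hn (by simp [h.1, h.2])
  smul_mem' c ψ hψ := by
    refine hψ.subset fun n hn h => hn ?_
    simp [h]

variable {ι} [Fintype ι] [DecidableEq ι]

/-- An operation on coefficient families that preserves finite support, as an operator on
`finiteParticle`. -/
noncomputable def ofCoeff (L : ((ι → ℕ) → ℂ) →ₗ[ℂ] ((ι → ℕ) → ℂ))
    (hL : ∀ f, {n | f n ≠ 0}.Finite → {n | L f n ≠ 0}.Finite) :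
    Module.End ℂ (finiteParticle ι) where
  toFun ψ := ⟨⟨L (ψ : BosonFock ι), (memℓp_zero (hL _ ψ.2)).of_exponent_ge zero_le⟩, hL _ ψ.2⟩
  map_add' ψ χ := by
    ext n
    exact congrFun (L.map_add (ψ : BosonFock ι) (χ : BosonFock ι)) n
  map_smul' c ψ := by
    ext n
    exact congrFun (L.map_smul c (ψ : BosonFock ι)) n

/-- The annihilation operator `a_k`: `a_k |n⟩ = √(n k) |n - e_k⟩`, that is,
`(a_k ψ) n = √(n k + 1) ψ (n + e_k)`. -/
noncomputable def annihilate (k : ι) : Module.End ℂ (finiteParticle ι) :=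
  ofCoeff
    { toFun := fun f n => (Real.sqrt (n k + 1) : ℂ) * f (n + Pi.single k 1)
      map_add' := fun f g => by ext n; simp [mul_add]
      map_smul' := fun c f => by ext n; simp [mul_left_comm] }
    (fun f hf => by
      have hinj : Function.Injective fun n : ι → ℕ => n + Pi.single k 1 :=
        add_left_injective _
      refine (hf.preimage hinj.injOn).subset fun n hn h => hn ?_
      simp [h])

/-- The creation operator `a_k^*`: `a_k^* |n⟩ = √(n k + 1) |n + e_k⟩`, that is,
`(a_k^* ψ) n = √(n k) ψ (n - e_k)`, which is zero if `n k = 0`. -/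
noncomputable def create (k : ι) : Module.End ℂ (finiteParticle ι) :=
  ofCoeff
    { toFun := fun f n => (Real.sqrt (n k) : ℂ) * f (n - Pi.single k 1)
      map_add' := fun f g => by ext n; simp [mul_add]
      map_smul' := fun c f => by ext n; simp [mul_left_comm] }
    (fun f hf => by
      refine (hf.image fun n => n + Pi.single k 1).subset fun n hn => ?_
      have hk : n k ≠ 0 := fun h => hn (by simp [h])
      refine ⟨n - Pi.single k 1, fun h => hn (by simp [h]), ?_⟩
      ext j
      by_cases hj : j = k
      · subst hj
        simp
        omega
      · simp [hj])

/-- The operator on the Fock space with domain `finiteParticle` given by `A`. -/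
noncomputable def onFock (A : Module.End ℂ (finiteParticle ι)) :
    BosonFock ι →ₗ.[ℂ] BosonFock ι where
  domain := finiteParticle ι
  toFun := (finiteParticle ι).subtype ∘ₗ A

/-- The particle number operator `∑ₖ a_k^* a_k` on `finiteParticle`. -/
noncomputable def numberOp (ι : Type*) [Fintype ι] [DecidableEq ι] :
    BosonFock ι →ₗ.[ℂ] BosonFock ι :=
  onFock (∑ k, create k * annihilate k)

/-- The quadratic boson operator
`∑ₖₗ Ωₖₗ a_k^* a_l + Bₖₗ a_k^* a_l^* + conj(Bₖₗ) a_k a_l + C` on `finiteParticle`. -/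
noncomputable def quadraticOp (Ω B : Matrix ι ι ℂ) (C : ℝ) :
    BosonFock ι →ₗ.[ℂ] BosonFock ι :=
  onFock ((∑ k, ∑ l, (Ω k l • (create k * annihilate l) + B k l • (create k * create l)
      + (starRingEnd ℂ (B k l)) • (annihilate k * annihilate l)))
    + (C : ℂ) • 1)

/-- The two-mode quadratic operator with `Ω = diag(ω₁, ω₂)` and `B` the real symmetric matrix with
zero diagonal and off-diagonal entry `b`, that is,
`ω₁ a₁^* a₁ + ω₂ a₂^* a₂ + 2 b (a₁^* a₂^* + a₂ a₁) + c`. -/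
noncomputable def twoModeOp (ω₁ ω₂ b c : ℝ) : BosonFock (Fin 2) →ₗ.[ℂ] BosonFock (Fin 2) :=
  quadraticOp !![(ω₁ : ℂ), 0; 0, (ω₂ : ℂ)] !![0, (b : ℂ); (b : ℂ), 0] c

end Bosons

/-! ### Commutators of unbounded operators through their graphs -/

section Commutators

variable {F : Type*} [NormedAddCommGroup F] [InnerProductSpace ℂ F]

/-! Write `N = a₀*a₀ + a₁*a₁` and `K = a₀*a₁* + a₀a₁`. Since `[a₀a₁, a₀*a₁*] = N + 1`, the double
commutator with `X = N` maps `ω(N + 1) + 2βK` to an operator of the same shape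
(`twoModeEnd_comm_comm`). On this family the flow is the system `ω' = -16β²`, `β' = -4βω`, with `4β²
- ω²` conserved. The value `0` gives `Y = f·(K - N - 1)` with `f' = 4f²`, whose domain is constant:
this is (i). The value `4b²` gives `ω = -2b tan(8bt)`, `β = b sec(8bt)`: this is (ii). In both cases
the normalised vector `Yφ` tends to a multiple of `(K - N - 1)φ`, so every non-zero `φ` blows up
because the closure of `K - N - 1` is injective (`eq_zero_of_pairCoeff_eq`).

The analytic input is `topologicalClosure_graph_twoModeOp`: the closure from finite-particle vectors
is the maximal operator given by the formal action on coefficients. Self-adjointness, equality of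
domains and the closed double commutator thereby become statements about coefficients. -/

theorem LinearPMap.mem_graph_mulOp {A B : F →ₗ.[ℂ] F} {x y z : F}
    (hB : (x, y) ∈ B.graph) (hA : (y, z) ∈ A.graph) : (x, z) ∈ (A.mulOp B).graph := by
  obtain ⟨⟨x', hx'⟩, hx, hy⟩ := (LinearPMap.mem_graph_iff B).1 hB
  obtain ⟨⟨y', hy'⟩, hyy, hz⟩ := (LinearPMap.mem_graph_iff A).1 hA
  simp only at hx hy hyy hz
  subst hx hy hyy hz
  have hmem : x' ∈ (B.domRestrict ((A.domain.comap B.toFun).map B.domain.subtype)).domain :=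
    ⟨⟨⟨x', hx'⟩, hy', rfl⟩, hx'⟩
  refine (LinearPMap.mem_graph_iff _).2 ⟨⟨x', hmem⟩, rfl, ?_⟩
  change A _ = A _
  congr 1

theorem LinearPMap.mem_graph_sub {A B : F →ₗ.[ℂ] F} {x y z : F}
    (hA : (x, y) ∈ A.graph) (hB : (x, z) ∈ B.graph) : (x, y - z) ∈ (A - B).graph := by
  obtain ⟨⟨x', hx'⟩, hx, hy⟩ := (LinearPMap.mem_graph_iff A).1 hA
  obtain ⟨⟨x'', hx''⟩, hxx, hz⟩ := (LinearPMap.mem_graph_iff B).1 hB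
  simp only at hx hy hxx hz
  subst hx hy hz
  subst hxx
  exact (LinearPMap.mem_graph_iff _).2 ⟨⟨x'', hx', hx''⟩, rfl, LinearPMap.sub_apply _ _ _⟩

/-- An invariant subspace lies in all the natural domains involved, so the commutator can be
computed there in the endomorphism algebra. -/
theorem LinearPMap.mem_graph_commOp {A B : F →ₗ.[ℂ] F} {S : Submodule ℂ F} {a b : Module.End ℂ S}
    (hA : ∀ x : S, ((x : F), (a x : F)) ∈ A.graph)
    (hB : ∀ x : S, ((x : F), (b x : F)) ∈ B.graph) (x : S) :
    ((x : F), ((a * b - b * a) x : F)) ∈ (A.commOp B).graph :=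
  LinearPMap.mem_graph_sub (LinearPMap.mem_graph_mulOp (hB x) (hA (b x)))
    (LinearPMap.mem_graph_mulOp (hA x) (hB (a x)))

end Commutators

/-! ### Square-summable families -/

section SquareSummable

variable {α : Type*}

theorem memℓp_two_iff {f : α → ℂ} : Memℓp f 2 ↔ Summable fun i => ‖f i‖ ^ 2 := by
  rw [memℓp_gen_iff (by norm_num)]
  simp

theorem memℓp_two_of_le {f g : α → ℂ} (hg : Memℓp g 2) (h : ∀ i, ‖f i‖ ≤ ‖g i‖) : Memℓp f 2 :=
  memℓp_two_iff.2 (Summable.of_nonneg_of_le (fun _ => by positivity)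
    (fun i => by gcongr; exact h i) (memℓp_two_iff.1 hg))

theorem norm_sq_eq_tsum (f : lp (fun _ : α => ℂ) 2) : ‖f‖ ^ 2 = ∑' i, ‖f i‖ ^ 2 := by
  simpa using lp.norm_rpow_eq_tsum (p := 2) (by norm_num) f

/-- Dominated convergence in `ℓ²`. -/
theorem tendsto_lp_two_of_dominated {f : ℕ → lp (fun _ : α => ℂ) 2} {f₀ : lp (fun _ : α => ℂ) 2}
    {g : α → ℝ} (hg : Summable fun i => g i ^ 2) (hfg : ∀ k i, ‖f k i - f₀ i‖ ≤ g i)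
    (hf : ∀ i, Tendsto (fun k => f k i) atTop (𝓝 (f₀ i))) : Tendsto f atTop (𝓝 f₀) := by
  rw [tendsto_iff_norm_sub_tendsto_zero]
  have h : Tendsto (fun k => ‖f k - f₀‖ ^ 2) atTop (𝓝 0) := by
    have h0 : Tendsto (fun k => ∑' i, ‖f k i - f₀ i‖ ^ 2) atTop (𝓝 (∑' _ : α, (0 : ℝ))) := by
      refine tendsto_tsum_of_dominated_convergence hg (fun i => ?_) (Eventually.of_forall
        fun k i => ?_)
      · simpa using (tendsto_iff_norm_sub_tendsto_zero.1 (hf i)).pow 2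
      · rw [Real.norm_of_nonneg (by positivity)]
        gcongr
        exact hfg k i
    simpa [norm_sq_eq_tsum] using h0
  simpa using h.sqrt

theorem tendsto_lp_two_cofinite (f : lp (fun _ : α => ℂ) 2) :
    Tendsto (fun i => f i) cofinite (𝓝 0) := by
  rw [tendsto_zero_iff_norm_tendsto_zero]
  simpa using (memℓp_two_iff.1 (lp.memℓp f)).tendsto_cofinite_zero.sqrt

theorem separableSpace_lp_two [Countable α] :
    TopologicalSpace.SeparableSpace (lp (fun _ : α => ℂ) 2) := by
  classical
  let s : Set (lp (fun _ : α => ℂ) 2) := Set.range fun i => lp.single 2 i (1 : ℂ)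
  have hs : TopologicalSpace.IsSeparable (closure (Submodule.span ℂ s : Set (lp (fun _ : α => ℂ) 2))) :=
    (Set.countable_range _).isSeparable.span.closure
  refine TopologicalSpace.isSeparable_univ_iff.1 (hs.mono fun f _ => ?_)
  refine mem_closure_of_tendsto (lp.hasSum_single (by norm_num) f)
    (Eventually.of_forall fun t => Submodule.sum_mem _ fun i _ => ?_)
  have h : lp.single (E := fun _ : α => ℂ) 2 i (f i) = f i • lp.single 2 i (1 : ℂ) := by
    rw [← lp.single_smul]
    simp
  rw [h]
  exact Submodule.smul_mem _ _ (Submodule.subset_span ⟨i, rfl⟩)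

end SquareSummable

/-! ### Coefficients of the two-mode operators -/

/-- The matrix element `√(n₀ n₁)` of `a₀ a₁` between `n` and `n - (1, 1)`. -/
noncomputable def pairWeight (n : Fin 2 → ℕ) : ℝ := √(n 0) * √(n 1)

/-- The coefficients of `(a₀^* a₁^* + a₀ a₁) f`. -/
noncomputable def pairCoeff (f : (Fin 2 → ℕ) → ℂ) (n : Fin 2 → ℕ) : ℂ :=
  pairWeight n * f (n - 1) + pairWeight (n + 1) * f (n + 1)

/-- The coefficients of `(ω (a₀^* a₀ + a₁^* a₁) + 2 β (a₀^* a₁^* + a₀ a₁) + c) f`. -/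
noncomputable def twoModeCoeff (ω β c : ℝ) (f : (Fin 2 → ℕ) → ℂ) (n : Fin 2 → ℕ) : ℂ :=
  (ω * (n 0 + n 1) + c) * f n + 2 * β * pairCoeff f n

/-- The endomorphism of `finiteParticle` underlying `twoModeOp ω ω β c`. -/
noncomputable def twoModeEnd (ω β c : ℝ) : Module.End ℂ (finiteParticle (Fin 2)) :=
  (∑ k, ∑ l, ((!![(ω : ℂ), 0; 0, (ω : ℂ)] : Matrix (Fin 2) (Fin 2) ℂ) k l •
        (create k * annihilate l)
      + (!![0, (β : ℂ); (β : ℂ), 0] : Matrix (Fin 2) (Fin 2) ℂ) k l • (create k * create l)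
      + (starRingEnd ℂ ((!![0, (β : ℂ); (β : ℂ), 0] : Matrix (Fin 2) (Fin 2) ℂ) k l)) •
        (annihilate k * annihilate l)))
    + (c : ℂ) • 1

theorem twoModeOp_eq_onFock (ω β c : ℝ) : twoModeOp ω ω β c = onFock (twoModeEnd ω β c) := rfl

section Ladder

variable {ι : Type*}

theorem annihilate_apply [DecidableEq ι] (k : ι) (ψ : finiteParticle ι) (n : ι → ℕ) :
    (annihilate k ψ : BosonFock ι) n
      = (√(n k + 1) : ℂ) * (ψ : BosonFock ι) (n + Pi.single k 1) := rfl

theorem create_apply [DecidableEq ι] (k : ι) (ψ : finiteParticle ι) (n : ι → ℕ) :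
    (create k ψ : BosonFock ι) n = (√(n k) : ℂ) * (ψ : BosonFock ι) (n - Pi.single k 1) := rfl

theorem finiteParticle_add_apply (ψ χ : finiteParticle ι) (n : ι → ℕ) :
    ((ψ + χ : finiteParticle ι) : BosonFock ι) n = (ψ : BosonFock ι) n + (χ : BosonFock ι) n := rfl

theorem finiteParticle_smul_apply (c : ℂ) (ψ : finiteParticle ι) (n : ι → ℕ) :
    ((c • ψ : finiteParticle ι) : BosonFock ι) n = c * (ψ : BosonFock ι) n := rfl

theorem create_annihilate_apply [DecidableEq ι] (k : ι) (ψ : finiteParticle ι) (n : ι → ℕ) :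
    (create k (annihilate k ψ) : BosonFock ι) n = n k * (ψ : BosonFock ι) n := by
  rw [create_apply, annihilate_apply]
  rcases Nat.eq_zero_or_pos (n k) with h | h
  · simp [h]
  · have h1 : n - Pi.single k 1 + Pi.single k 1 = n := by
      ext j
      by_cases hj : j = k
      · subst hj
        simp
        omega
      · simp [hj]
    have h2 : (((n - Pi.single k 1 : ι → ℕ) k : ℕ) : ℝ) + 1 = n k := by
      simp [Nat.cast_sub (Nat.succ_le_of_lt h)]
    rw [h1, h2, ← mul_assoc, ← Complex.ofReal_mul, Real.mul_self_sqrt (by positivity)]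
    simp

end Ladder

theorem single_add_single_fin_two : (Pi.single 0 1 + Pi.single 1 1 : Fin 2 → ℕ) = 1 := by
  ext j
  fin_cases j <;> rfl

/-- The two off-diagonal entries of `B` contribute equally, whence `2β`. The truncated `n - 1` in
`pairCoeff` is harmless: if a mode is empty, `pairWeight n = 0`. -/
theorem twoModeEnd_apply (ω β c : ℝ) (ψ : finiteParticle (Fin 2)) (n : Fin 2 → ℕ) :
    (twoModeEnd ω β c ψ : BosonFock (Fin 2)) n = twoModeCoeff ω β c (ψ : BosonFock (Fin 2)) n := by
  have h1 : (create 0 (create 1 ψ) : BosonFock (Fin 2)) n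
      = pairWeight n * (ψ : BosonFock (Fin 2)) (n - 1) := by
    rw [create_apply, create_apply, ← single_add_single_fin_two, tsub_tsub, pairWeight]
    simp [mul_assoc]
  have h2 : (create 1 (create 0 ψ) : BosonFock (Fin 2)) n
      = pairWeight n * (ψ : BosonFock (Fin 2)) (n - 1) := by
    rw [create_apply, create_apply, ← single_add_single_fin_two, tsub_tsub, pairWeight,
      add_comm (Pi.single 1 1)]
    simp
    ring
  have h3 : (annihilate 0 (annihilate 1 ψ) : BosonFock (Fin 2)) n
      = pairWeight (n + 1) * (ψ : BosonFock (Fin 2)) (n + 1) := by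
    rw [annihilate_apply, annihilate_apply, ← single_add_single_fin_two, add_assoc, pairWeight]
    simp [mul_assoc]
  have h4 : (annihilate 1 (annihilate 0 ψ) : BosonFock (Fin 2)) n
      = pairWeight (n + 1) * (ψ : BosonFock (Fin 2)) (n + 1) := by
    rw [annihilate_apply, annihilate_apply, add_assoc, add_comm (Pi.single 1 1),
      ← single_add_single_fin_two, pairWeight]
    simp
    ring
  simp only [twoModeEnd, Fin.sum_univ_two, twoModeCoeff, pairCoeff, Matrix.of_apply,
    Matrix.cons_val_zero, Matrix.cons_val_one, Complex.conj_ofReal, map_zero,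
    zero_smul, add_zero, zero_add, LinearMap.add_apply, LinearMap.smul_apply, Module.End.mul_apply,
    Module.End.one_apply, finiteParticle_add_apply, finiteParticle_smul_apply, h1, h2, h3, h4,
    create_annihilate_apply]
  ring

theorem numberOp_eq : numberOp (Fin 2) = twoModeOp 1 1 0 0 := by
  rw [twoModeOp_eq_onFock, numberOp]
  congr 1
  refine LinearMap.ext fun ψ => Subtype.ext (lp.ext (funext fun n => ?_))
  rw [twoModeEnd_apply]
  simp [twoModeCoeff, create_annihilate_apply, add_mul]

theorem mem_graph_twoModeOp_iff {ω β c : ℝ} {φ ψ : BosonFock (Fin 2)} :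
    (φ, ψ) ∈ (twoModeOp ω ω β c).graph ↔
      φ ∈ finiteParticle (Fin 2) ∧ ∀ n, ψ n = twoModeCoeff ω β c φ n := by
  rw [twoModeOp_eq_onFock, LinearPMap.mem_graph_iff]
  constructor
  · rintro ⟨y, rfl, rfl⟩
    exact ⟨y.2, twoModeEnd_apply ω β c y⟩
  · rintro ⟨h, hψ⟩
    refine ⟨⟨φ, h⟩, rfl, lp.ext (funext fun n => ?_)⟩
    exact (twoModeEnd_apply ω β c ⟨φ, h⟩ n).trans (hψ n).symm

/-! ### Finite-particle cutoffs -/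

/-- The piecewise linear cutoff in the number of particles. -/
noncomputable def cutoff (k : ℕ) (n : Fin 2 → ℕ) : ℝ := max 0 (1 - ((n 0 : ℝ) + n 1) / (k + 1))

theorem cutoff_nonneg (k : ℕ) (n : Fin 2 → ℕ) : 0 ≤ cutoff k n := le_max_left _ _

theorem cutoff_le_one (k : ℕ) (n : Fin 2 → ℕ) : cutoff k n ≤ 1 :=
  max_le zero_le_one (by simpa using (by positivity : (0 : ℝ) ≤ ((n 0 : ℝ) + n 1) / (k + 1)))

theorem abs_cutoff_sub_one_le (k : ℕ) (n : Fin 2 → ℕ) : |cutoff k n - 1| ≤ 1 :=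
  abs_le.2 ⟨by linarith [cutoff_nonneg k n], by linarith [cutoff_le_one k n]⟩

theorem cutoff_eq_zero {k : ℕ} {n : Fin 2 → ℕ} (h : k + 1 ≤ n 0 + n 1) : cutoff k n = 0 := by
  refine max_eq_left ?_
  have h' : (k : ℝ) + 1 ≤ n 0 + n 1 := by exact_mod_cast h
  rw [sub_nonpos, le_div_iff₀ (by positivity)]
  linarith

theorem tendsto_cutoff (n : Fin 2 → ℕ) : Tendsto (fun k => cutoff k n) atTop (𝓝 1) := by
  have h : Tendsto (fun k : ℕ => 1 - ((n 0 : ℝ) + n 1) / ((k : ℝ) + 1)) atTop (𝓝 (1 - 0)) :=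
    tendsto_const_nhds.sub (tendsto_const_nhds.div_atTop
      (tendsto_atTop_add_const_right _ _ tendsto_natCast_atTop_atTop))
  simpa [cutoff] using (tendsto_const_nhds (x := (0 : ℝ))).max h

theorem pairWeight_nonneg (n : Fin 2 → ℕ) : 0 ≤ pairWeight n := by
  unfold pairWeight
  positivity

theorem pairWeight_sq (n : Fin 2 → ℕ) : pairWeight n ^ 2 = n 0 * n 1 := by
  rw [pairWeight, mul_pow, Real.sq_sqrt (by positivity), Real.sq_sqrt (by positivity)]

theorem pairWeight_le (n : Fin 2 → ℕ) : pairWeight n ≤ ((n 0 : ℝ) + n 1) / 2 := by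
  have h0 : (0 : ℝ) ≤ n 0 := by positivity
  have h1 : (0 : ℝ) ≤ n 1 := by positivity
  refine abs_le_of_sq_le_sq' ?_ (by positivity) |>.2
  rw [pairWeight_sq]
  nlinarith [sq_nonneg ((n 0 : ℝ) - n 1)]

/-- Either `n` is raised from another occupation number by one pair, or `n` contains no pair. -/
theorem exists_eq_add_one_or (n : Fin 2 → ℕ) : (∃ m, n = m + 1) ∨ pairWeight n = 0 := by
  by_cases h : 1 ≤ n
  · exact Or.inl ⟨n - 1, (tsub_add_cancel_of_le h).symm⟩
  · right
    have h' : n 0 = 0 ∨ n 1 = 0 := by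
      by_contra hn
      refine h fun i => ?_
      fin_cases i <;> simp <;> omega
    rcases h' with h' | h' <;> simp [pairWeight, h']

/-- The commutator of the cutoff with the pair terms is bounded uniformly in `k`: adding a pair
changes the cutoff by at most `2/(k+1)`, and where it changes the weight is at most `(k+2)/2`. -/
theorem pairWeight_mul_cutoff_sub_le (k : ℕ) (n : Fin 2 → ℕ) :
    pairWeight (n + 1) * |cutoff k (n + 1) - cutoff k n| ≤ 3 := by
  by_cases h : k + 1 ≤ n 0 + n 1
  · rw [cutoff_eq_zero h, cutoff_eq_zero (by simp; omega)]
    simp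
  · have hk : (0 : ℝ) < k + 1 := by positivity
    have h' : (n 0 : ℝ) + n 1 ≤ k := by exact_mod_cast (by omega : n 0 + n 1 ≤ k)
    have h1 : pairWeight (n + 1) ≤ (k + 2) / 2 := by
      refine (pairWeight_le _).trans ?_
      simp
      linarith
    have h2 : |cutoff k (n + 1) - cutoff k n| ≤ 2 / (k + 1) := by
      rw [cutoff, cutoff, max_comm 0, max_comm 0]
      refine (abs_max_sub_max_le_abs _ _ _).trans (le_of_eq ?_)
      rw [abs_of_nonpos]
      · simp
        ring
      · simp
        gcongr <;> linarith
    calc _ ≤ ((k : ℝ) + 2) / 2 * (2 / (k + 1)) := by gcongr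
      _ ≤ 3 := by
        field_simp
        nlinarith [(Nat.cast_nonneg k : (0 : ℝ) ≤ k)]

/-- The product of a vector with the cutoff. -/
noncomputable def cutoffVec (k : ℕ) (φ : BosonFock (Fin 2)) : BosonFock (Fin 2) :=
  ⟨fun n => cutoff k n * φ n, memℓp_two_of_le (lp.memℓp φ) fun n => by
    rw [norm_mul, Complex.norm_of_nonneg (cutoff_nonneg k n)]
    exact mul_le_of_le_one_left (norm_nonneg _) (cutoff_le_one k n)⟩

theorem cutoffVec_apply (k : ℕ) (φ : BosonFock (Fin 2)) (n : Fin 2 → ℕ) :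
    cutoffVec k φ n = cutoff k n * φ n := rfl

theorem cutoffVec_mem (k : ℕ) (φ : BosonFock (Fin 2)) :
    cutoffVec k φ ∈ finiteParticle (Fin 2) := by
  refine (Set.finite_Iic (fun _ => k : Fin 2 → ℕ)).subset fun n hn => ?_
  have h : n 0 + n 1 ≤ k := by
    by_contra h
    exact hn (by rw [cutoffVec_apply, cutoff_eq_zero (by omega)]; simp)
  intro i
  fin_cases i <;> simp <;> omega

theorem tendsto_cutoffVec (φ : BosonFock (Fin 2)) :
    Tendsto (fun k => cutoffVec k φ) atTop (𝓝 φ) := by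
  refine tendsto_lp_two_of_dominated (memℓp_two_iff.1 (lp.memℓp φ)) (fun k n => ?_) fun n => ?_
  · rw [cutoffVec_apply, ← sub_one_mul, norm_mul]
    refine mul_le_of_le_one_left (norm_nonneg _) ?_
    rw [← Complex.ofReal_one, ← Complex.ofReal_sub, Complex.norm_real]
    exact abs_cutoff_sub_one_le k n
  · simpa [cutoffVec_apply] using
      ((Complex.continuous_ofReal.tendsto _).comp (tendsto_cutoff n)).mul_const (φ n)

/-! ### Shifts by one pair -/

theorem memℓp_shift_down {f : (Fin 2 → ℕ) → ℂ} (hf : Memℓp f 2) :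
    Memℓp (fun n => f (n + 1)) 2 :=
  memℓp_two_iff.2 ((memℓp_two_iff.1 hf).comp_injective
    (add_left_injective (1 : Fin 2 → ℕ)))

open Classical in
/-- The family `f` raised by one pair. -/
noncomputable def pairShift (f : (Fin 2 → ℕ) → ℂ) (n : Fin 2 → ℕ) : ℂ :=
  if 1 ≤ n then f (n - 1) else 0

theorem pairShift_add_one (f : (Fin 2 → ℕ) → ℂ) (n : Fin 2 → ℕ) : pairShift f (n + 1) = f n := by
  simp [pairShift]

theorem memℓp_shift_up {f : (Fin 2 → ℕ) → ℂ} (hf : Memℓp f 2) :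
    Memℓp (pairShift f) 2 := by
  refine memℓp_two_iff.2 ?_
  rw [← (add_left_injective (1 : Fin 2 → ℕ)).summable_iff]
  · simpa [Function.comp_def, pairShift_add_one] using memℓp_two_iff.1 hf
  · intro n hn
    have h : ¬ 1 ≤ n := fun h => hn ⟨n - 1, tsub_add_cancel_of_le h⟩
    simp [pairShift, h]

/-! ### The graph of the closure -/

theorem continuous_lp_two_apply (n : Fin 2 → ℕ) : Continuous fun φ : BosonFock (Fin 2) => φ n :=
  (continuous_apply n).comp (lp.uniformContinuous_coe (p := 2)).continuous

/-- The pairs `(φ, ψ)` with `ψ` given by the formal action of the two-mode operator on `φ`. -/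
noncomputable def twoModeGraph (ω β c : ℝ) :
    Submodule ℂ (BosonFock (Fin 2) × BosonFock (Fin 2)) where
  carrier := {x | ∀ n, x.2 n = twoModeCoeff ω β c x.1 n}
  zero_mem' n := by simp [twoModeCoeff, pairCoeff]
  add_mem' {x y} hx hy n := by
    simp only [Prod.snd_add, Prod.fst_add, lp.coeFn_add, Pi.add_apply,
      hx n, hy n, twoModeCoeff, pairCoeff]
    ring
  smul_mem' a x hx n := by
    simp only [Prod.smul_snd, Prod.smul_fst, lp.coeFn_smul, Pi.smul_apply, smul_eq_mul,
      hx n, twoModeCoeff, pairCoeff]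
    ring

theorem mem_twoModeGraph {ω β c : ℝ} {φ ψ : BosonFock (Fin 2)} :
    (φ, ψ) ∈ twoModeGraph ω β c ↔ ∀ n, ψ n = twoModeCoeff ω β c φ n := Iff.rfl

theorem isClosed_twoModeGraph (ω β c : ℝ) :
    IsClosed (twoModeGraph ω β c : Set (BosonFock (Fin 2) × BosonFock (Fin 2))) := by
  have h : (twoModeGraph ω β c : Set (BosonFock (Fin 2) × BosonFock (Fin 2)))
      = ⋂ n, {x | x.2 n = twoModeCoeff ω β c x.1 n} := by
    ext x
    simp only [Set.mem_iInter]
    rfl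
  rw [h]
  refine isClosed_iInter fun n => isClosed_eq ((continuous_lp_two_apply n).comp continuous_snd) ?_
  have h1 (m : Fin 2 → ℕ) := (continuous_lp_two_apply m).comp
    (continuous_fst (X := BosonFock (Fin 2)) (Y := BosonFock (Fin 2)))
  simp only [Function.comp_def] at h1
  unfold twoModeCoeff pairCoeff
  exact (continuous_const.mul (h1 n)).add (continuous_const.mul
    ((continuous_const.mul (h1 _)).add (continuous_const.mul (h1 _))))

/-- Product rule: the cutoff acts on the image, plus the commutator of the cutoff with the pair
terms. -/
theorem twoModeCoeff_cutoffVec_sub (ω β c : ℝ) (k : ℕ) (φ : BosonFock (Fin 2)) (n : Fin 2 → ℕ) :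
    twoModeCoeff ω β c (cutoffVec k φ) n - twoModeCoeff ω β c φ n
      = (cutoff k n - 1) * twoModeCoeff ω β c φ n
        + 2 * β * (pairWeight n * (cutoff k (n - 1) - cutoff k n) * φ (n - 1)
          + pairWeight (n + 1) * (cutoff k (n + 1) - cutoff k n) * φ (n + 1)) := by
  simp only [twoModeCoeff, pairCoeff, cutoffVec_apply]
  ring

/-- The majorant does not depend on `k` and is square-summable as soon as the formal image is, as
dominated convergence requires. -/
theorem norm_twoModeCoeff_cutoffVec_sub_le (ω β c : ℝ) (k : ℕ) (φ : BosonFock (Fin 2))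
    (n : Fin 2 → ℕ) :
    ‖twoModeCoeff ω β c (cutoffVec k φ) n - twoModeCoeff ω β c φ n‖
      ≤ ‖twoModeCoeff ω β c φ n‖
        + 6 * |β| * (‖pairShift φ n‖ + ‖φ (n + 1)‖) := by
  have h1 : ‖((cutoff k n : ℂ) - 1)‖ ≤ 1 := by
    rw [← Complex.ofReal_one, ← Complex.ofReal_sub, Complex.norm_real]
    exact abs_cutoff_sub_one_le k n
  have h2 (n) : ‖(pairWeight (n + 1) : ℂ) * (cutoff k (n + 1) - cutoff k n)‖ ≤ 3 := by
    rw [norm_mul, ← Complex.ofReal_sub, Complex.norm_real, Complex.norm_real,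
      Real.norm_of_nonneg (pairWeight_nonneg _)]
    exact pairWeight_mul_cutoff_sub_le k n
  have h3 : ‖(pairWeight n : ℂ) * (cutoff k (n - 1) - cutoff k n) * φ (n - 1)‖
      ≤ 3 * ‖pairShift φ n‖ := by
    rcases exists_eq_add_one_or n with ⟨m, rfl⟩ | h
    · rw [norm_mul, add_tsub_cancel_right, pairShift_add_one, ← neg_sub, mul_neg, norm_neg]
      gcongr
      exact h2 m
    · simp [h]
  rw [twoModeCoeff_cutoffVec_sub]
  calc _ ≤ 1 * ‖twoModeCoeff ω β c φ n‖
        + 2 * |β| * (3 * ‖pairShift φ n‖ + 3 * ‖φ (n + 1)‖) := by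
        refine (norm_add_le _ _).trans (add_le_add ?_ ?_)
        · rw [norm_mul]
          gcongr
        · rw [norm_mul, norm_mul, Complex.norm_real, Complex.norm_two, Real.norm_eq_abs]
          gcongr
          refine (norm_add_le _ _).trans (add_le_add h3 ?_)
          rw [norm_mul]
          gcongr
          exact h2 n
    _ = _ := by ring

theorem graph_twoModeOp_le (ω β c : ℝ) : (twoModeOp ω ω β c).graph ≤ twoModeGraph ω β c :=
  fun _ h => (mem_graph_twoModeOp_iff.1 h).2

/-- Minimal and maximal realisations coincide. The formal graph is closed because each coefficient
is continuous; conversely the cutoffs of `φ` converge to `φ` together with their images. -/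
theorem topologicalClosure_graph_twoModeOp (ω β c : ℝ) :
    (twoModeOp ω ω β c).graph.topologicalClosure = twoModeGraph ω β c := by
  refine le_antisymm (Submodule.topologicalClosure_minimal _ (graph_twoModeOp_le ω β c)
    (isClosed_twoModeGraph ω β c)) ?_
  rintro ⟨φ, ψ⟩ h
  have hψ := mem_twoModeGraph.1 h
  have hmem (k : ℕ) : (cutoffVec k φ, (twoModeEnd ω β c ⟨_, cutoffVec_mem k φ⟩ :
      BosonFock (Fin 2))) ∈ (twoModeOp ω ω β c).graph :=
    mem_graph_twoModeOp_iff.2 ⟨cutoffVec_mem k φ, twoModeEnd_apply ω β c _⟩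
  suffices ht : Tendsto (fun k => (twoModeEnd ω β c ⟨_, cutoffVec_mem k φ⟩ : BosonFock (Fin 2)))
      atTop (𝓝 ψ) from
    mem_closure_of_tendsto ((tendsto_cutoffVec φ).prodMk_nhds ht) (Eventually.of_forall hmem)
  let g : (Fin 2 → ℕ) → ℝ := fun n => ‖ψ n‖
        + 6 * |β| * (‖pairShift φ n‖ + ‖φ (n + 1)‖)
  have hg : Summable fun n => g n ^ 2 := by
    have hn {f : (Fin 2 → ℕ) → ℂ} (hf : Memℓp f 2) : Memℓp (fun n => ((‖f n‖ : ℝ) : ℂ)) 2 :=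
      memℓp_two_of_le hf (by simp)
    have h := memℓp_two_iff.1 ((hn (lp.memℓp ψ)).add (((hn (memℓp_shift_up (lp.memℓp φ))).add
      (hn (memℓp_shift_down (lp.memℓp φ)))).const_mul ((6 * |β| : ℝ) : ℂ)))
    refine h.congr fun n => ?_
    simp only [Pi.add_apply, ← Complex.ofReal_mul, ← Complex.ofReal_add, Complex.norm_real,
      Real.norm_eq_abs, sq_abs]
    rfl
  refine tendsto_lp_two_of_dominated hg (fun k n => ?_) fun n => ?_
  · rw [twoModeEnd_apply]
    simp only [g]
    rw [hψ n]
    exact norm_twoModeCoeff_cutoffVec_sub_le ω β c k φ n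
  · simp only [twoModeEnd_apply]
    rw [hψ n]
    have hc (m) : Tendsto (fun k => cutoffVec k φ m) atTop (𝓝 (φ m)) :=
      ((continuous_lp_two_apply m).tendsto φ).comp (tendsto_cutoffVec φ)
    exact ((hc n).const_mul _).add ((((hc _).const_mul _).add ((hc _).const_mul _)).const_mul _)

/-! ### Self-adjointness -/

theorem isClosable_twoModeOp (ω β c : ℝ) : (twoModeOp ω ω β c).IsClosable := by
  refine ⟨(twoModeGraph ω β c).toLinearPMap, ?_⟩
  rw [topologicalClosure_graph_twoModeOp, Submodule.toLinearPMap_graph_eq]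
  rintro ⟨φ, ψ⟩ h (rfl : φ = 0)
  exact lp.ext (funext fun n => (mem_twoModeGraph.1 h n).trans (by simp [twoModeCoeff, pairCoeff]))

theorem graph_closure_twoModeOp (ω β c : ℝ) :
    (twoModeOp ω ω β c).closure.graph = twoModeGraph ω β c := by
  rw [← (isClosable_twoModeOp ω β c).graph_closure_eq_closure_graph,
    topologicalClosure_graph_twoModeOp]

theorem mem_graph_closure_twoModeOp {ω β c : ℝ} {φ ψ : BosonFock (Fin 2)} :
    (φ, ψ) ∈ (twoModeOp ω ω β c).closure.graph ↔ ∀ n, ψ n = twoModeCoeff ω β c φ n := by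
  rw [graph_closure_twoModeOp, mem_twoModeGraph]

theorem domain_le_closure (ω β c : ℝ) :
    finiteParticle (Fin 2) ≤ (twoModeOp ω ω β c).closure.domain :=
  (LinearPMap.le_closure (twoModeOp ω ω β c)).1

theorem dense_finiteParticle : Dense (finiteParticle (Fin 2) : Set (BosonFock (Fin 2))) :=
  fun φ => mem_closure_of_tendsto (tendsto_cutoffVec φ)
    (Eventually.of_forall fun k => cutoffVec_mem k φ)

theorem lp_two_single_apply (n m : Fin 2 → ℕ) :
    lp.single (E := fun _ : Fin 2 → ℕ => ℂ) 2 n (1 : ℂ) m = if m = n then 1 else 0 := by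
  rw [lp.single_apply, Pi.single_apply]

/-- The image of the occupation number state `n`. -/
noncomputable def twoModeVec (ω β c : ℝ) (n : Fin 2 → ℕ) : BosonFock (Fin 2) :=
  ((ω * (n 0 + n 1) + c : ℝ) : ℂ) • lp.single 2 n (1 : ℂ)
    + ((2 * β * pairWeight n : ℝ) : ℂ) • lp.single 2 (n - 1) (1 : ℂ)
    + ((2 * β * pairWeight (n + 1) : ℝ) : ℂ) • lp.single 2 (n + 1) (1 : ℂ)

theorem twoModeVec_apply (ω β c : ℝ) (n m : Fin 2 → ℕ) :
    twoModeVec ω β c n m = twoModeCoeff ω β c (lp.single 2 n (1 : ℂ)) m := by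
  simp only [twoModeVec, twoModeCoeff, pairCoeff, lp.coeFn_add, lp.coeFn_smul, Pi.add_apply,
    Pi.smul_apply, smul_eq_mul, lp_two_single_apply]
  have h1 : (pairWeight n : ℂ) * (if m = n - 1 then 1 else 0)
      = pairWeight (m + 1) * (if m + 1 = n then 1 else 0) := by
    rcases exists_eq_add_one_or n with ⟨k, rfl⟩ | h
    · by_cases hk : m = k <;> simp [hk]
    · by_cases hm : m + 1 = n
      · simp [hm, h]
      · simp [hm, h]
  have h2 : (pairWeight m : ℂ) * (if m - 1 = n then 1 else 0)
      = pairWeight (n + 1) * (if m = n + 1 then 1 else 0) := by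
    rcases exists_eq_add_one_or m with ⟨k, rfl⟩ | h
    · by_cases hk : k = n <;> simp [hk]
    · by_cases hm : m = n + 1
      · simp [← hm, h]
      · simp [hm, h]
  have h3 : ((m 0 : ℂ) + m 1) * (if m = n then 1 else 0)
      = ((n 0 : ℂ) + n 1) * (if m = n then 1 else 0) := by
    by_cases hm : m = n <;> simp [hm]
  push_cast
  linear_combination 2 * (β : ℂ) * h1 - 2 * (β : ℂ) * h2 - (ω : ℂ) * h3

/-- The matrix of the formal action is real and symmetric. -/
theorem inner_twoModeVec (ω β c : ℝ) (n : Fin 2 → ℕ) (φ : BosonFock (Fin 2)) :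
    inner ℂ (twoModeVec ω β c n) φ = twoModeCoeff ω β c φ n := by
  simp only [twoModeVec, inner_add_left, inner_smul_left, lp.inner_single_left, Complex.conj_ofReal]
  simp [twoModeCoeff, pairCoeff]
  ring

theorem eq_sum_single_of_mem_finiteParticle {x : BosonFock (Fin 2)}
    (hx : x ∈ finiteParticle (Fin 2)) :
    x = ∑ n ∈ Set.Finite.toFinset hx, x n • lp.single 2 n (1 : ℂ) := by
  refine lp.ext (funext fun m => ?_)
  rw [lp.coeFn_sum, Finset.sum_apply]
  simp only [lp.coeFn_smul, Pi.smul_apply, lp_two_single_apply, smul_eq_mul, mul_ite, mul_one,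
    mul_zero, Finset.sum_ite_eq]
  by_cases hm : x m = 0
  · simp [hm]
  · exact (if_pos ((Set.Finite.mem_toFinset hx).2 hm)).symm

theorem sum_mem_twoModeGraph (ω β c : ℝ) (a : (Fin 2 → ℕ) → ℂ) (t : Finset (Fin 2 → ℕ)) :
    (∑ n ∈ t, a n • lp.single 2 n (1 : ℂ), ∑ n ∈ t, a n • twoModeVec ω β c n) ∈
      twoModeGraph ω β c := by
  induction t using Finset.induction_on with
  | empty => exact (twoModeGraph ω β c).zero_mem
  | insert n t hn ih =>
    rw [Finset.sum_insert hn, Finset.sum_insert hn]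
    have h1 : (lp.single 2 n (1 : ℂ), twoModeVec ω β c n) ∈ twoModeGraph ω β c :=
      twoModeVec_apply ω β c n
    exact (twoModeGraph ω β c).add_mem ((twoModeGraph ω β c).smul_mem (a n) h1) ih

/-- Testing the adjoint relation on occupation states shows that the adjoint acts formally, hence
lies in the maximal operator, which is the closure. Conversely, symmetry holds on finite
combinations of these states and passes to the closed graph. -/
theorem isSelfAdjoint_closure_twoModeOp (ω β c : ℝ) :
    IsSelfAdjoint (twoModeOp ω ω β c).closure := by
  rw [LinearPMap.isSelfAdjoint_def]
  refine LinearPMap.eq_of_eq_graph ?_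
  rw [LinearPMap.adjoint_graph_eq_graph_adjoint
    (dense_finiteParticle.mono (domain_le_closure ω β c)), graph_closure_twoModeOp]
  ext ⟨φ, ψ⟩
  rw [Submodule.mem_adjoint_iff, mem_twoModeGraph]
  constructor
  · intro h n
    have := h (lp.single 2 n (1 : ℂ)) (twoModeVec ω β c n) (twoModeVec_apply ω β c n)
    rw [inner_twoModeVec, lp.inner_single_left, sub_eq_zero] at this
    simpa using this.symm
  · intro h a b hab
    rw [← SetLike.mem_coe, ← topologicalClosure_graph_twoModeOp] at hab
    have hcl : IsClosed {x : BosonFock (Fin 2) × BosonFock (Fin 2) |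
        inner ℂ x.2 φ - inner ℂ x.1 ψ = 0} :=
      isClosed_eq (by fun_prop) continuous_const
    refine closure_minimal (s := ((twoModeOp ω ω β c).graph : Set _)) ?_ hcl hab
    rintro ⟨x, y⟩ hxy
    obtain ⟨hx, hy⟩ := mem_graph_twoModeOp_iff.1 hxy
    have hsum := eq_sum_single_of_mem_finiteParticle hx
    have hsum' : y = ∑ n ∈ hx.toFinset, x n • twoModeVec ω β c n := by
      have h1 := sum_mem_twoModeGraph ω β c x hx.toFinset
      rw [← hsum] at h1
      exact lp.ext (funext fun n => (hy n).trans (h1 n).symm)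
    change inner ℂ y φ - inner ℂ x ψ = 0
    conv_lhs => rw [hsum']; arg 2; rw [hsum]
    rw [sum_inner, sum_inner, sub_eq_zero]
    refine Finset.sum_congr rfl fun n _ => ?_
    rw [inner_smul_left, inner_smul_left, inner_twoModeVec, lp.inner_single_left, h n]
    simp

theorem isUnbounded_closure_twoModeOp {ω β c : ℝ}
    (h : ∀ C : ℝ, ∃ n m, C < ‖twoModeVec ω β c n m‖) :
    (twoModeOp ω ω β c).closure.IsUnbounded := by
  rintro ⟨C, hC⟩
  obtain ⟨n, m, hnm⟩ := h C
  obtain ⟨x, hx, hy⟩ := (LinearPMap.mem_graph_iff _).1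
    (mem_graph_closure_twoModeOp.2 (twoModeVec_apply ω β c n))
  have := hC x
  simp only at hx hy
  rw [hx, hy, lp.norm_single (by norm_num)] at this
  have h2 := lp.norm_apply_le_norm (by norm_num) (twoModeVec ω β c n) m
  simp at this
  linarith

theorem isUnbounded_closure_twoModeOp_of_ne_zero {ω β c : ℝ} (h : β ≠ 0) :
    (twoModeOp ω ω β c).closure.IsUnbounded := by
  refine isUnbounded_closure_twoModeOp fun C => ?_
  obtain ⟨k, hk⟩ := exists_nat_gt (C / |2 * β|)
  -- The matrix element from `(k, k)` to `(k+1, k+1)` is `2β(k+1)`.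
  refine ⟨fun _ => k, (fun _ => k) + 1, ?_⟩
  have h0 : ((fun _ => k) + 1 : Fin 2 → ℕ) ≠ fun _ => k := fun h => by simpa using congrFun h 0
  have h0' : ((fun _ => k) + 1 : Fin 2 → ℕ) ≠ (fun _ => k) - 1 := fun h => by
    have := congrFun h 0
    simp at this
    omega
  have hw : pairWeight ((fun _ => k) + 1) = k + 1 := by
    simp [pairWeight]
    exact Real.mul_self_sqrt (by positivity)
  have hv : twoModeVec ω β c (fun _ => k) ((fun _ => k) + 1) = ((2 * β * (k + 1) : ℝ) : ℂ) := by
    simp only [twoModeVec, lp.coeFn_add, lp.coeFn_smul, Pi.add_apply,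
      Pi.smul_apply, smul_eq_mul, lp_two_single_apply, hw, if_neg h0, if_neg h0']
    simp
  rw [hv, Complex.norm_real, Real.norm_eq_abs, abs_mul, abs_of_pos (by positivity : (0 : ℝ) < k + 1)]
  rw [div_lt_iff₀ (by positivity)] at hk
  nlinarith [abs_nonneg (2 * β)]

theorem isUnbounded_closure_numberOp : (numberOp (Fin 2)).closure.IsUnbounded := by
  rw [numberOp_eq]
  refine isUnbounded_closure_twoModeOp fun C => ?_
  obtain ⟨k, hk⟩ := exists_nat_gt C
  refine ⟨fun _ => k, fun _ => k, ?_⟩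
  have hv : twoModeVec 1 0 0 (fun _ => k) (fun _ => k) = ((k + k : ℝ) : ℂ) := by
    simp only [twoModeVec, lp.coeFn_add, lp.coeFn_smul, Pi.add_apply,
      Pi.smul_apply, smul_eq_mul, lp_two_single_apply]
    simp
  rw [hv, Complex.norm_real, Real.norm_of_nonneg (by positivity)]
  linarith [(Nat.cast_nonneg k : (0 : ℝ) ≤ k)]

theorem isNonneg_closure_numberOp : (numberOp (Fin 2)).closure.IsNonneg := by
  rw [numberOp_eq]
  intro x
  have h := mem_graph_closure_twoModeOp.1 (LinearPMap.mem_graph _ x)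
  have hs := lp.hasSum_inner (𝕜 := ℂ) (x : BosonFock (Fin 2)) ((twoModeOp 1 1 0 0).closure x)
  refine (Complex.hasSum_re hs).nonneg fun n => ?_
  rw [h n]
  have : inner ℂ ((x : BosonFock (Fin 2)) n) (twoModeCoeff 1 0 0 (x : BosonFock (Fin 2)) n)
      = (((n 0 : ℝ) + n 1) * ‖(x : BosonFock (Fin 2)) n‖ ^ 2 : ℝ) := by
    have h2 := Complex.mul_conj' ((x : BosonFock (Fin 2)) n)
    simp [twoModeCoeff]
    linear_combination ((n 0 : ℂ) + n 1) * h2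
  rw [this, Complex.ofReal_re]
  positivity

/-! ### The double commutator -/

/-- A pair carries two particles, so each pair term is an eigenvector of the commutator with `N`,
with eigenvalue `±2`. -/
theorem twoModeEnd_comm_apply (ω β c : ℝ) (ψ : finiteParticle (Fin 2)) (n : Fin 2 → ℕ) :
    ((twoModeEnd ω β c * twoModeEnd 1 0 0 - twoModeEnd 1 0 0 * twoModeEnd ω β c) ψ :
      BosonFock (Fin 2)) n = 4 * β * (pairWeight (n + 1) * (ψ : BosonFock (Fin 2)) (n + 1)
        - pairWeight n * (ψ : BosonFock (Fin 2)) (n - 1)) := by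
  have hsub (x y : finiteParticle (Fin 2)) : ((x - y : finiteParticle (Fin 2)) :
      BosonFock (Fin 2)) n = (x : BosonFock (Fin 2)) n - (y : BosonFock (Fin 2)) n := rfl
  rw [LinearMap.sub_apply, hsub, Module.End.mul_apply, Module.End.mul_apply]
  simp only [twoModeEnd_apply, twoModeCoeff, pairCoeff]
  rcases exists_eq_add_one_or n with ⟨m, rfl⟩ | h
  · simp
    ring
  · simp [h]
    ring

/-- This is the source of the equations `ω' = c' = -16β²`, `β' = -4βω`. The relation `[a₀a₁, a₀*a₁*]
= N + 1` enters as `pairWeight (n + 1) ^ 2 - pairWeight n ^ 2 = n 0 + n 1 + 1`. -/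
theorem twoModeEnd_comm_comm (ω β c : ℝ) :
    twoModeEnd ω β c * (twoModeEnd ω β c * twoModeEnd 1 0 0 - twoModeEnd 1 0 0 * twoModeEnd ω β c)
      - (twoModeEnd ω β c * twoModeEnd 1 0 0 - twoModeEnd 1 0 0 * twoModeEnd ω β c)
        * twoModeEnd ω β c
      = twoModeEnd (-16 * β ^ 2) (-4 * β * ω) (-16 * β ^ 2) := by
  refine LinearMap.ext fun ψ => Subtype.ext (lp.ext (funext fun n => ?_))
  have hsub (x y : finiteParticle (Fin 2)) : ((x - y : finiteParticle (Fin 2)) :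
      BosonFock (Fin 2)) n = (x : BosonFock (Fin 2)) n - (y : BosonFock (Fin 2)) n := rfl
  rw [LinearMap.sub_apply, hsub, Module.End.mul_apply, Module.End.mul_apply]
  have hw (m : Fin 2 → ℕ) : (pairWeight (m + 1) : ℂ) ^ 2 = (m 0 + 1) * (m 1 + 1) := by
    rw [← Complex.ofReal_pow, pairWeight_sq]
    simp
  simp only [twoModeEnd_comm_apply, twoModeEnd_apply, twoModeCoeff, pairCoeff]
  have h2 := hw n
  rcases exists_eq_add_one_or n with ⟨m, rfl⟩ | h
  · have h1 := hw m
    simp only [add_tsub_cancel_right, Pi.add_apply, Pi.one_apply, Nat.cast_add, Nat.cast_one,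
      Complex.ofReal_neg, Complex.ofReal_mul, Complex.ofReal_pow, Complex.ofReal_ofNat] at h2 ⊢
    linear_combination 16 * (β : ℂ) ^ 2 * (ψ : BosonFock (Fin 2)) (m + 1) * (h1 - h2)
  · have h0 : (n 0 : ℂ) * n 1 = 0 := by
      have := pairWeight_sq n
      rw [h] at this
      exact_mod_cast this.symm.trans (zero_pow two_ne_zero)
    simp only [h, add_tsub_cancel_right, Pi.add_apply, Pi.one_apply, Nat.cast_add, Nat.cast_one,
      Complex.ofReal_neg, Complex.ofReal_mul, Complex.ofReal_pow, Complex.ofReal_ofNat,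
      Complex.ofReal_zero] at h2 ⊢
    linear_combination 16 * (β : ℂ) ^ 2 * (ψ : BosonFock (Fin 2)) n * (- h2 - h0)

/-- An inclusion suffices: taking closures puts the whole formal graph into the closure of the
double commutator, without determining its natural domain. -/
theorem graph_twoModeOp_le_commOp (ω β c : ℝ) :
    (twoModeOp (-16 * β ^ 2) (-16 * β ^ 2) (-4 * β * ω) (-16 * β ^ 2)).graph ≤
      ((twoModeOp ω ω β c).closure.commOp
        ((twoModeOp ω ω β c).closure.commOp (numberOp (Fin 2)).closure)).graph := by
  rintro ⟨φ, ψ⟩ h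
  obtain ⟨hφ, hψ⟩ := mem_graph_twoModeOp_iff.1 h
  have hY (ω β c : ℝ) (x : finiteParticle (Fin 2)) :
      ((x : BosonFock (Fin 2)), (twoModeEnd ω β c x : BosonFock (Fin 2))) ∈
        (twoModeOp ω ω β c).closure.graph :=
    mem_graph_closure_twoModeOp.2 (twoModeEnd_apply ω β c x)
  have h1 := LinearPMap.mem_graph_commOp (hY ω β c)
    (LinearPMap.mem_graph_commOp (hY ω β c) (hY 1 0 0)) ⟨φ, hφ⟩
  rw [twoModeEnd_comm_comm, ← numberOp_eq] at h1
  convert h1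
  exact lp.ext (funext fun n => (hψ n).trans (twoModeEnd_apply _ _ _ ⟨φ, hφ⟩ n).symm)

theorem isLocalFlow_twoModeOp {ω β c : ℝ → ℝ} {T : ℝ} {D : Submodule ℂ (BosonFock (Fin 2))}
    (hD : finiteParticle (Fin 2) ≤ D)
    (h : ∀ φ ∈ D, ∃ u v : ℝ → BosonFock (Fin 2), ∀ t ∈ Set.Ico 0 T,
      (∀ n, u t n = twoModeCoeff (ω t) (β t) (c t) φ n) ∧
      (∀ n, v t n = twoModeCoeff (-16 * β t ^ 2) (-4 * β t * ω t) (-16 * β t ^ 2) φ n) ∧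
      HasDerivWithinAt u (v t) (Set.Ico 0 T) t) :
    IsLocalFlow (numberOp (Fin 2)).closure
      (fun t => (twoModeOp (ω t) (ω t) (β t) (c t)).closure) T (finiteParticle (Fin 2)) D where
  core_le := hD
  core_X := LinearPMap.closureHasCore (numberOp (Fin 2))
  core_Y t _ := LinearPMap.closureHasCore (twoModeOp (ω t) (ω t) (β t) (c t))
  flow_core φ hφ := by
    obtain ⟨u, v, huv⟩ := h φ (hD hφ)
    refine ⟨u, v, fun t ht => ?_⟩
    obtain ⟨h1, h2, h3⟩ := huv t ht
    exact ⟨mem_graph_closure_twoModeOp.2 h1,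
      graph_twoModeOp_le_commOp _ _ _ (mem_graph_twoModeOp_iff.2 ⟨hφ, h2⟩), h3⟩
  flow_dom φ hφ := by
    obtain ⟨u, v, huv⟩ := h φ hφ
    refine ⟨u, v, fun t ht => ?_⟩
    obtain ⟨h1, h2, h3⟩ := huv t ht
    refine ⟨mem_graph_closure_twoModeOp.2 h1, ?_, h3⟩
    refine Submodule.topologicalClosure_mono (graph_twoModeOp_le_commOp (ω t) (β t) (c t)) ?_
    rw [topologicalClosure_graph_twoModeOp]
    exact h2

/-! ### The kernel of the limiting operator -/

/-- The second-order recursion starts at a boundary and collapses to a first-order one, along which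
`‖s m‖` cannot decrease; a sequence tending to zero must then vanish. -/
theorem eq_zero_of_sector_recursion {s : ℕ → ℂ} {d : ℕ} (hs : Tendsto s atTop (𝓝 0))
    (h : ∀ m : ℕ, (√m * √(m + d) : ℝ) * s (m - 1) + (√(m + 1) * √(m + 1 + d) : ℝ) * s (m + 1)
      = (2 * m + d + 1) * s m) (m : ℕ) : s m = 0 := by
  have hsq (x : ℝ) (hx : 0 ≤ x) : ((√x : ℝ) : ℂ) * (√x : ℝ) = x := by
    rw [← Complex.ofReal_mul, Real.mul_self_sqrt hx]
  -- At `m = 0` the lower term has weight zero. Afterwards the previous relation, times `√(m + 1)`,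
  -- eliminates the lower term, and a factor `√(m + 2 + d)` cancels.
  have hstep : ∀ m : ℕ, ((√(m + 1) : ℝ) : ℂ) * s (m + 1) = (√(m + 1 + d) : ℝ) * s m := by
    intro m
    induction m with
    | zero =>
      have h0 := h 0
      have h1 := hsq (1 + d) (by positivity)
      have h2 : ((√(1 + d) : ℝ) : ℂ) ≠ 0 := by
        rw [Complex.ofReal_ne_zero]
        positivity
      suffices hs : s 1 = (√(1 + d) : ℝ) * s 0 by simpa using hs
      refine mul_left_cancel₀ h2 ?_
      simp at h0 h1
      linear_combination h0 - s 0 * h1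
    | succ m ih =>
      have h0 := h (m + 1)
      push_cast at h0 ⊢
      have h1 := hsq (m + 1 + 1 + d) (by positivity)
      have h2 : ((√(m + 1 + 1 + d) : ℝ) : ℂ) ≠ 0 := by
        rw [Complex.ofReal_ne_zero]
        positivity
      have h3 := hsq (m + 1) (by positivity)
      refine mul_left_cancel₀ h2 ?_
      push_cast at h1 h3
      linear_combination h0 - s (m + 1) * h1 + (√(m + 1) : ℝ) * ih - s (m + 1) * h3
  have hmono : Monotone fun m => ‖s m‖ := by
    refine monotone_nat_of_le_succ fun m => ?_
    have h1 := congrArg norm (hstep m)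
    rw [norm_mul, norm_mul, Complex.norm_real, Complex.norm_real,
      Real.norm_of_nonneg (by positivity), Real.norm_of_nonneg (by positivity)] at h1
    have h2 : √((m : ℝ) + 1) ≤ √((m : ℝ) + 1 + d) := Real.sqrt_le_sqrt (by simp)
    have h3 : 0 < √((m : ℝ) + 1) := by positivity
    refine le_of_mul_le_mul_left ?_ h3
    rw [h1]
    gcongr
  have := hmono.ge_of_tendsto (tendsto_zero_iff_norm_tendsto_zero.1 hs) m
  exact norm_le_zero_iff.1 this

/-- Pairs preserve `n 0 - n 1`, so the kernel equation decouples into sectors; `d` is the absolute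
value of this difference, and the smaller occupation number runs along the sector. -/
theorem eq_zero_of_pairCoeff_eq {φ : BosonFock (Fin 2)}
    (h : ∀ n, pairCoeff φ n = (n 0 + n 1 + 1) * φ n) : φ = 0 := by
  have hlim {e : ℕ → Fin 2 → ℕ} (he : Function.Injective e) :
      Tendsto (fun m => φ (e m)) atTop (𝓝 0) := by
    have := (tendsto_lp_two_cofinite φ).comp he.tendsto_cofinite
    rwa [Nat.cofinite_eq_atTop] at this
  refine lp.ext (funext fun n => ?_)
  rcases le_total (n 1) (n 0) with hn | hn
  · obtain ⟨d, hd⟩ := Nat.exists_eq_add_of_le hn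
    have hinj : Function.Injective fun m : ℕ => (![m + d, m] : Fin 2 → ℕ) :=
      fun a b hab => by simpa using congrFun hab 1
    have hz := eq_zero_of_sector_recursion (d := d) (hlim hinj) (fun m => ?_) (n 1)
    · have hn' : n = ![n 1 + d, n 1] := by
        ext i
        fin_cases i <;> simp [hd]
      rw [hn']
      simpa using hz
    · have h1 := h ![m + d, m]
      have e1 : (![m + d, m] + 1 : Fin 2 → ℕ) = ![m + 1 + d, m + 1] := by
        ext i
        fin_cases i <;> simp <;> omega
      rw [pairCoeff, e1] at h1
      rcases Nat.eq_zero_or_pos m with rfl | hm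
      · simp [pairWeight] at h1 ⊢
        linear_combination h1
      · have e2 : (![m + d, m] - 1 : Fin 2 → ℕ) = ![m - 1 + d, m - 1] := by
          ext i
          fin_cases i <;> simp <;> omega
        rw [e2] at h1
        simp [pairWeight] at h1 ⊢
        linear_combination h1
  · obtain ⟨d, hd⟩ := Nat.exists_eq_add_of_le hn
    have hinj : Function.Injective fun m : ℕ => (![m, m + d] : Fin 2 → ℕ) :=
      fun a b hab => by simpa using congrFun hab 0
    have hz := eq_zero_of_sector_recursion (d := d) (hlim hinj) (fun m => ?_) (n 0)
    · have hn' : n = ![n 0, n 0 + d] := by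
        ext i
        fin_cases i <;> simp [hd]
      rw [hn']
      simpa using hz
    · have h1 := h ![m, m + d]
      have e1 : (![m, m + d] + 1 : Fin 2 → ℕ) = ![m + 1, m + 1 + d] := by
        ext i
        fin_cases i <;> simp <;> omega
      rw [pairCoeff, e1] at h1
      rcases Nat.eq_zero_or_pos m with rfl | hm
      · simp [pairWeight] at h1 ⊢
        linear_combination h1
      · have e2 : (![m, m + d] - 1 : Fin 2 → ℕ) = ![m - 1, m - 1 + d] := by
          ext i
          fin_cases i <;> simp <;> omega
        rw [e2] at h1
        simp [pairWeight] at h1 ⊢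
        linear_combination h1

/-! ### The blowing-up solution with constant domain -/

theorem twoModeCoeff_mul (r ω β c : ℝ) (f : (Fin 2 → ℕ) → ℂ) (n : Fin 2 → ℕ) :
    twoModeCoeff (r * ω) (r * β) (r * c) f n = r * twoModeCoeff ω β c f n := by
  simp only [twoModeCoeff]
  push_cast
  ring

/-- `r` times the closure of `a₀^* a₁^* + a₀ a₁ - a₀^* a₀ - a₁^* a₁ - 1`. -/
noncomputable def parabolicOp (r : ℝ) : BosonFock (Fin 2) →ₗ.[ℂ] BosonFock (Fin 2) :=
  (twoModeOp (r * -1) (r * -1) (r * (1 / 2)) (r * -1)).closure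

theorem mem_graph_parabolicOp {r : ℝ} {φ ψ : BosonFock (Fin 2)} :
    (φ, ψ) ∈ (parabolicOp r).graph ↔ ∀ n, ψ n = r * twoModeCoeff (-1) (1 / 2) (-1) φ n := by
  simp only [parabolicOp, mem_graph_closure_twoModeOp, twoModeCoeff_mul]

theorem mem_domain_parabolicOp {r : ℝ} (hr : r ≠ 0) {φ : BosonFock (Fin 2)} :
    φ ∈ (parabolicOp r).domain ↔
      ∃ a : BosonFock (Fin 2), ∀ n, a n = twoModeCoeff (-1) (1 / 2) (-1) φ n := by
  rw [LinearPMap.mem_domain_iff]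
  have hr' : (r : ℂ) ≠ 0 := Complex.ofReal_ne_zero.2 hr
  constructor
  · rintro ⟨ψ, hψ⟩
    rw [mem_graph_parabolicOp] at hψ
    refine ⟨(r : ℂ)⁻¹ • ψ, fun n => ?_⟩
    rw [lp.coeFn_smul, Pi.smul_apply, smul_eq_mul, hψ n, inv_mul_cancel_left₀ hr']
  · rintro ⟨a, ha⟩
    refine ⟨(r : ℂ) • a, mem_graph_parabolicOp.2 fun n => ?_⟩
    rw [lp.coeFn_smul, Pi.smul_apply, smul_eq_mul, ha n]

theorem parabolic_ne_zero {φ a : BosonFock (Fin 2)}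
    (ha : ∀ n, a n = twoModeCoeff (-1) (1 / 2) (-1) φ n) (hφ : φ ≠ 0) : a ≠ 0 := by
  rintro rfl
  refine hφ (eq_zero_of_pairCoeff_eq fun n => ?_)
  have h := ha n
  simp [twoModeCoeff] at h
  linear_combination -h

theorem exists_blowUp_constant_domain :
    ∃ (F : Type) (_ : NormedAddCommGroup F) (_ : InnerProductSpace ℂ F) (_ : CompleteSpace F)
      (_ : TopologicalSpace.SeparableSpace F)
      (X : F →ₗ.[ℂ] F) (Y : ℝ → F →ₗ.[ℂ] F) (T : ℝ) (C : Submodule ℂ F),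
      0 < T ∧
      IsSelfAdjoint X ∧ X.IsNonneg ∧ X.IsUnbounded ∧
      (∀ t ∈ Set.Ico 0 T, IsSelfAdjoint (Y t) ∧ (Y t).IsUnbounded ∧
        (Y t).domain = (Y 0).domain) ∧
      IsLocalFlow X Y T C (Y 0).domain ∧
      BlowsUpOn Y T (Y 0).domain := by
  -- On the ray `ω = c = -f`, `2β = f`, all the coefficient equations reduce to `f' = 4f²`.
  let f : ℝ → ℝ := fun t => (4 * (1 - t))⁻¹
  have hf {t : ℝ} (ht : t ∈ Set.Ico (0 : ℝ) 1) : 0 < f t :=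
    inv_pos.2 (by linarith [ht.2])
  have hf0 : f 0 ≠ 0 := (hf ⟨le_rfl, one_pos⟩).ne'
  have hderiv {t : ℝ} (ht : t ∈ Set.Ico (0 : ℝ) 1) : HasDerivAt f (4 * f t ^ 2) t := by
    have h1 : 1 - t ≠ 0 := by linarith [ht.2]
    have h : HasDerivAt f _ t :=
      (((hasDerivAt_id t).const_sub 1).const_mul 4).inv (mul_ne_zero four_ne_zero h1)
    refine h.congr_deriv ?_
    simp only [f, id]
    field_simp
  refine ⟨BosonFock (Fin 2), inferInstance, inferInstance, inferInstance, separableSpace_lp_two,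
    (numberOp (Fin 2)).closure, fun t => parabolicOp (f t), 1, finiteParticle (Fin 2), one_pos,
    numberOp_eq ▸ isSelfAdjoint_closure_twoModeOp 1 0 0, isNonneg_closure_numberOp,
    isUnbounded_closure_numberOp, fun t ht => ⟨isSelfAdjoint_closure_twoModeOp _ _ _,
      isUnbounded_closure_twoModeOp_of_ne_zero (mul_ne_zero (hf ht).ne' (by norm_num)), ?_⟩, ?_,
      ?_⟩
  · ext φ
    rw [mem_domain_parabolicOp (hf ht).ne', mem_domain_parabolicOp hf0]
  · refine isLocalFlow_twoModeOp (domain_le_closure _ _ _) fun φ hφ => ?_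
    obtain ⟨a, ha⟩ := (mem_domain_parabolicOp hf0).1 hφ
    refine ⟨fun t => f t • a, fun t => (4 * f t ^ 2) • a, fun t ht => ⟨fun n => ?_, fun n => ?_,
      ((hderiv ht).smul_const a).hasDerivWithinAt⟩⟩
    · rw [twoModeCoeff_mul, ← ha n, lp.coeFn_smul, Pi.smul_apply, Complex.real_smul]
    · have h : twoModeCoeff (-16 * (f t * (1 / 2)) ^ 2) (-4 * (f t * (1 / 2)) * (f t * -1))
          (-16 * (f t * (1 / 2)) ^ 2) φ n
          = twoModeCoeff (4 * f t ^ 2 * -1) (4 * f t ^ 2 * (1 / 2)) (4 * f t ^ 2 * -1) φ n := by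
        congr 1 <;> ring
      rw [h, twoModeCoeff_mul, ← ha n, lp.coeFn_smul, Pi.smul_apply, Complex.real_smul]
  · intro φ hφ hφ0
    obtain ⟨a, ha⟩ := (mem_domain_parabolicOp hf0).1 hφ
    refine ⟨fun t => f t • a, fun t _ => mem_graph_parabolicOp.2 fun n => ?_, ?_⟩
    · rw [← ha n, lp.coeFn_smul, Pi.smul_apply, Complex.real_smul]
    · have hlim : Tendsto f (𝓝[<] 1) atTop := by
        refine tendsto_inv_nhdsGT_zero.comp (tendsto_nhdsWithin_iff.2 ⟨?_, ?_⟩)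
        · have : Tendsto (fun t : ℝ => 4 * (1 - t)) (𝓝 1) (𝓝 (4 * (1 - 1))) :=
            Continuous.tendsto (by fun_prop) 1
          simpa using this.mono_left nhdsWithin_le_nhds
        · filter_upwards [self_mem_nhdsWithin] with t ht
          have : t < 1 := ht
          simpa using this
      have h := (tendsto_abs_atTop_atTop.comp hlim).atTop_mul_const
        (norm_pos_iff.2 (parabolic_ne_zero ha hφ0))
      simpa [norm_smul, Function.comp_def] using h

/-! ### The two-mode example -/

/-- The pair terms are bounded relative to `N + 1`, since both weights are at most `n 0 + n 1 + 1`.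
Thus on `D(N)` the flow is a combination of two fixed vectors with scalar coefficients. -/
theorem exists_pairCoeff_of_mem_domain {φ : BosonFock (Fin 2)}
    (hφ : φ ∈ (numberOp (Fin 2)).closure.domain) :
    ∃ M K : BosonFock (Fin 2), (∀ n, M n = ((n 0 : ℂ) + n 1 + 1) * φ n) ∧
      ∀ n, K n = pairCoeff φ n := by
  rw [numberOp_eq, LinearPMap.mem_domain_iff] at hφ
  obtain ⟨ψ, hψ⟩ := hφ
  rw [mem_graph_closure_twoModeOp] at hψ
  have hM (n) : (ψ + φ) n = ((n 0 : ℂ) + n 1 + 1) * φ n := by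
    rw [lp.coeFn_add, Pi.add_apply, hψ n]
    simp [twoModeCoeff]
    ring
  have hMn (n) : ‖(ψ + φ) n‖ = ((n 0 : ℝ) + n 1 + 1) * ‖φ n‖ := by
    rw [hM, norm_mul]
    congr 1
    rw [← Complex.norm_of_nonneg (by positivity : (0 : ℝ) ≤ (n 0 : ℝ) + n 1 + 1)]
    simp
  have h1 : Memℓp (fun n => (pairWeight (n + 1) : ℂ) * φ n) 2 := by
    refine memℓp_two_of_le (lp.memℓp (ψ + φ)) fun n => ?_
    rw [hMn, norm_mul, Complex.norm_of_nonneg (pairWeight_nonneg _)]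
    gcongr
    refine (pairWeight_le _).trans ?_
    simp
    linarith [(Nat.cast_nonneg (n 0) : (0 : ℝ) ≤ n 0), (Nat.cast_nonneg (n 1) : (0 : ℝ) ≤ n 1)]
  have h2 : Memℓp (fun n => (pairWeight n : ℂ) * φ n) 2 := by
    refine memℓp_two_of_le (lp.memℓp (ψ + φ)) fun n => ?_
    rw [hMn, norm_mul, Complex.norm_of_nonneg (pairWeight_nonneg _)]
    gcongr
    refine (pairWeight_le _).trans ?_
    linarith [(Nat.cast_nonneg (n 0) : (0 : ℝ) ≤ n 0), (Nat.cast_nonneg (n 1) : (0 : ℝ) ≤ n 1)]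
  refine ⟨ψ + φ, ⟨_, (memℓp_shift_up h1).add (memℓp_shift_down h2)⟩, hM, fun n => ?_⟩
  change pairShift (fun n => (pairWeight (n + 1) : ℂ) * φ n) n + _ = _
  rw [pairCoeff]
  congr 1
  rcases exists_eq_add_one_or n with ⟨m, rfl⟩ | h
  · simp [pairShift_add_one]
  · by_cases hn : 1 ≤ n
    · simp [pairShift, hn, tsub_add_cancel_of_le hn]
    · simp [pairShift, hn, h]

theorem twoModeCoeff_self (ω β : ℝ) (f : (Fin 2 → ℕ) → ℂ) (n : Fin 2 → ℕ) :
    twoModeCoeff ω β ω f n = ω * (((n 0 : ℂ) + n 1 + 1) * f n) + (2 * β : ℝ) * pairCoeff f n := by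
  simp only [twoModeCoeff]
  push_cast
  ring

theorem exists_blowUp_twoMode (b : ℝ) (hb : 0 < b) :
    ∃ ω₁ ω₂ β c : ℝ → ℝ, ∃ (X : BosonFock (Fin 2) →ₗ.[ℂ] BosonFock (Fin 2))
      (Y : ℝ → BosonFock (Fin 2) →ₗ.[ℂ] BosonFock (Fin 2)) (T : ℝ),
      T = Real.pi / (16 * b) ∧
      X = (numberOp (Fin 2)).closure ∧
      (∀ t, Y t = (twoModeOp (ω₁ t) (ω₂ t) (β t) (c t)).closure) ∧
      ω₁ 0 = 0 ∧ ω₂ 0 = 0 ∧ β 0 = b ∧ c 0 = 0 ∧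
      IsSelfAdjoint X ∧ X.IsNonneg ∧ X.IsUnbounded ∧
      (∀ t ∈ Set.Ico 0 T, IsSelfAdjoint (Y t) ∧ (Y t).IsUnbounded) ∧
      IsLocalFlow X Y T (finiteParticle (Fin 2)) X.domain ∧
      BlowsUpOn Y T X.domain := by
  let T : ℝ := Real.pi / (16 * b)
  -- The solution on the level `4β² - ω² = 4b²`; taking `c = ω` turns `N` into `N + 1`.
  let ω : ℝ → ℝ := fun t => -2 * b * (Real.sin (8 * b * t) / Real.cos (8 * b * t))
  let β : ℝ → ℝ := fun t => b * (Real.cos (8 * b * t))⁻¹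
  have hT : 8 * b * T = Real.pi / 2 := by
    simp only [T]
    field_simp
    norm_num
  have hcos {t : ℝ} (ht : t ∈ Set.Ico 0 T) : 0 < Real.cos (8 * b * t) := by
    have h1 : 8 * b * t < 8 * b * T := by
      have := ht.2
      gcongr
    have h2 : 0 ≤ 8 * b * t := mul_nonneg (by positivity) ht.1
    exact Real.cos_pos_of_mem_Ioo ⟨by linarith [Real.pi_pos], by linarith⟩
  have hlin (t : ℝ) : HasDerivAt (fun t => 8 * b * t) (8 * b) t := by
    simpa using (hasDerivAt_id t).const_mul (8 * b)
  have hω {t : ℝ} (ht : t ∈ Set.Ico 0 T) : HasDerivAt ω (-16 * β t ^ 2) t := by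
    have h0 := (hcos ht).ne'
    have h : HasDerivAt ω _ t := ((hlin t).sin.div (hlin t).cos h0).const_mul (-2 * b)
    refine h.congr_deriv ?_
    simp only [β]
    have hs := Real.sin_sq_add_cos_sq (8 * b * t)
    generalize Real.cos (8 * b * t) = x at h0 hs ⊢
    generalize Real.sin (8 * b * t) = y at hs ⊢
    field_simp
    linear_combination -16 * hs
  have hβ {t : ℝ} (ht : t ∈ Set.Ico 0 T) : HasDerivAt β (-4 * β t * ω t) t := by
    have h0 := (hcos ht).ne'
    have h : HasDerivAt β _ t := ((hlin t).cos.inv h0).const_mul b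
    refine h.congr_deriv ?_
    simp only [β, ω]
    field_simp
    ring
  have hβ0 {t : ℝ} (ht : t ∈ Set.Ico 0 T) : β t ≠ 0 :=
    mul_ne_zero hb.ne' (inv_ne_zero (hcos ht).ne')
  refine ⟨ω, ω, β, ω, _, fun t => (twoModeOp (ω t) (ω t) (β t) (ω t)).closure, T, rfl, rfl,
    fun _ => rfl, by simp [ω], by simp [ω], by simp [β], by simp [ω],
    numberOp_eq ▸ isSelfAdjoint_closure_twoModeOp 1 0 0, isNonneg_closure_numberOp,
    isUnbounded_closure_numberOp, fun t ht => ⟨isSelfAdjoint_closure_twoModeOp _ _ _,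
      isUnbounded_closure_twoModeOp_of_ne_zero (hβ0 ht)⟩, ?_, ?_⟩
  · refine isLocalFlow_twoModeOp (LinearPMap.le_closure (numberOp (Fin 2))).1 fun φ hφ => ?_
    obtain ⟨M, K, hM, hK⟩ := exists_pairCoeff_of_mem_domain hφ
    refine ⟨fun t => ω t • M + (2 * β t) • K,
      fun t => (-16 * β t ^ 2) • M + (2 * (-4 * β t * ω t)) • K, fun t ht => ⟨fun n => ?_,
      fun n => ?_, (((hω ht).smul_const M).add
        (((hβ ht).const_mul 2).smul_const K)).hasDerivWithinAt⟩⟩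
    · rw [twoModeCoeff_self, ← hM, ← hK]
      simp only [lp.coeFn_add, lp.coeFn_smul, Pi.add_apply, Pi.smul_apply, Complex.real_smul]
    · rw [twoModeCoeff_self, ← hM, ← hK]
      simp only [lp.coeFn_add, lp.coeFn_smul, Pi.add_apply, Pi.smul_apply, Complex.real_smul]
  · intro φ hφ hφ0
    obtain ⟨M, K, hM, hK⟩ := exists_pairCoeff_of_mem_domain hφ
    refine ⟨fun t => ω t • M + (2 * β t) • K, fun t ht => mem_graph_closure_twoModeOp.2
      fun n => ?_, ?_⟩
    · rw [twoModeCoeff_self, ← hM, ← hK]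
      simp only [lp.coeFn_add, lp.coeFn_smul, Pi.add_apply, Pi.smul_apply, Complex.real_smul]
    · have hne : K - M ≠ 0 := by
        refine parabolic_ne_zero (φ := φ) (fun n => ?_) hφ0
        rw [lp.coeFn_sub, Pi.sub_apply, hM, hK]
        simp [twoModeCoeff]
        ring
      -- With the divergent scalar factored out, the remaining vector tends to `K - M`, which is
      -- non-zero by `hne`.
      have hfac (t : ℝ) : ω t • M + (2 * β t) • K
          = (2 * b * (Real.cos (8 * b * t))⁻¹) • (K - Real.sin (8 * b * t) • M) := by
        simp only [ω, β, smul_sub, smul_smul]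
        module
      have hnear : Tendsto (fun t : ℝ => 8 * b * t) (𝓝[<] T) (𝓝 (Real.pi / 2)) := by
        rw [← hT]
        exact ((continuous_const.mul continuous_id).tendsto T).mono_left nhdsWithin_le_nhds
      have hnorm : Tendsto (fun t => ‖K - Real.sin (8 * b * t) • M‖) (𝓝[<] T) (𝓝 ‖K - M‖) := by
        have h := (Real.continuous_sin.tendsto _).comp hnear
        rw [Real.sin_pi_div_two] at h
        simpa using (tendsto_const_nhds.sub (h.smul_const M)).norm
      have hTpos : 0 < T := by
        simp only [T]
        positivity
      have hev : ∀ᶠ t in 𝓝[<] T, t ∈ Set.Ico 0 T := by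
        filter_upwards [Ioo_mem_nhdsLT hTpos] with t ht using ⟨ht.1.le, ht.2⟩
      have hinv : Tendsto (fun t => 2 * b * (Real.cos (8 * b * t))⁻¹) (𝓝[<] T) atTop := by
        refine Tendsto.const_mul_atTop (by positivity)
          (tendsto_inv_nhdsGT_zero.comp (tendsto_nhdsWithin_iff.2 ⟨?_, ?_⟩))
        · have h := (Real.continuous_cos.tendsto _).comp hnear
          rwa [Real.cos_pi_div_two] at h
        · filter_upwards [hev] with t ht using hcos ht
      refine (hinv.atTop_mul_pos (norm_pos_iff.2 hne) hnorm).congr' ?_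
      filter_upwards [hev] with t ht
      have := hcos ht
      rw [hfac, norm_smul, Real.norm_of_nonneg (by positivity)]

theorem mainTheorem9 :
    (∃ (F : Type) (_ : NormedAddCommGroup F) (_ : InnerProductSpace ℂ F) (_ : CompleteSpace F)
      (_ : TopologicalSpace.SeparableSpace F)
      (X : F →ₗ.[ℂ] F) (Y : ℝ → F →ₗ.[ℂ] F) (T : ℝ) (C : Submodule ℂ F),
      0 < T ∧
      IsSelfAdjoint X ∧ X.IsNonneg ∧ X.IsUnbounded ∧
      (∀ t ∈ Set.Ico 0 T, IsSelfAdjoint (Y t) ∧ (Y t).IsUnbounded ∧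
        (Y t).domain = (Y 0).domain) ∧
      IsLocalFlow X Y T C (Y 0).domain ∧
      BlowsUpOn Y T (Y 0).domain) ∧
    (∀ b : ℝ, 0 < b →
      ∃ ω₁ ω₂ β c : ℝ → ℝ, ∃ (X : BosonFock (Fin 2) →ₗ.[ℂ] BosonFock (Fin 2))
        (Y : ℝ → BosonFock (Fin 2) →ₗ.[ℂ] BosonFock (Fin 2)) (T : ℝ),
        T = Real.pi / (16 * b) ∧
        X = (numberOp (Fin 2)).closure ∧
        (∀ t, Y t = (twoModeOp (ω₁ t) (ω₂ t) (β t) (c t)).closure) ∧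
        ω₁ 0 = 0 ∧ ω₂ 0 = 0 ∧ β 0 = b ∧ c 0 = 0 ∧
        IsSelfAdjoint X ∧ X.IsNonneg ∧ X.IsUnbounded ∧
        (∀ t ∈ Set.Ico 0 T, IsSelfAdjoint (Y t) ∧ (Y t).IsUnbounded) ∧
        IsLocalFlow X Y T (finiteParticle (Fin 2)) X.domain ∧
        BlowsUpOn Y T X.domain) :=
  ⟨exists_blowUp_constant_domain, exists_blowUp_twoMode⟩
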